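/- Let $(Q,\langle\!\langle\cdot,\cdot\rangle\!\rangle)$ be a smooth Riemannian manifold (finite-dimensional, Hausdorff, without boundary), let $G$ be a Lie group with Lie algebra $\mathfrak g$ acting smoothly and properly on $Q$ by isometries, and let $X_\lambda$, $\lambda\in\mathbb R$, be a family of smooth $G$-equivariant vector fields on $Q$. A point $q\in Q$ is a relative equilibrium of $X_\lambda$ if $X_\lambda(q)=\frac{d}{dt}\big|_{t=0}\exp(t\xi)\cdot q$ for some $\xi\in\mathfrak g$. Let $q_e\in Q$ be a relative equilibrium (for instance an equilibrium) of $X_{\lambda_0}$, and let $G_{q_e}$ be its isotropy group, which acts linearly on $T_{q_e}Q$ by $h\cdot v=T_{q_e}\Phi_h(v)$, where $\Phi_h(q)=h\cdot q$. Let $V\subset T_{q_e}Q$ be a $G_{q_e}$-invariant open neighborhood of $0$, contained in the domain of the Riemannian exponential map $\operatorname{Exp}_{q_e}$, which $\operatorname{Exp}_{q_e}$ maps diffeomorphically onto an open set $U\subset Q$; then $U$ is $G_{q_e}$-invariant. Let $\operatorname{Exp}_{q_e}^*X_\lambda$ be the pullback vector field $v\mapsto (T_v\operatorname{Exp}_{q_e})^{-1}X_\lambda(\operatorname{Exp}_{q_e}(v))$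 on $V$. Let $H\subset G_{q_e}$ be a subgroup, and suppose that there are $\epsilon>0$ and a continuous curve $\gamma:[\lambda_0,\lambda_0+\epsilon]\to V$ with $\gamma(\lambda_0)=0$ such that, for every $\lambda\in(\lambda_0,\lambda_0+\epsilon]$, the point $\gamma(\lambda)$ is a relative equilibrium of $\operatorname{Exp}_{q_e}^*X_\lambda$ for the linear $G_{q_e}$-action (that is, $(\operatorname{Exp}_{q_e}^*X_\lambda)(\gamma(\lambda))=\frac{d}{dt}\big|_{t=0}\exp(t\xi)\cdot\gamma(\lambda)$ for some $\xi$ in the Lie algebra of $G_{q_e}$) and its isotropy group in $G_{q_e}$ is conjugate in $G_{q_e}$ to $H$. Then $\operatorname{Exp}_{q_e}\circ\gamma:[\lambda_0,\lambda_0+\epsilon]\to U$ is a continuous curve, and for every $\lambda\in[\lambda_0,\lambda_0+\epsilon]$ the point $\operatorname{Exp}_{q_e}(\gamma(\lambda))$ is a relative equilibrium of $X_\lambda$. For $\lambda>\lambda_0$ the isotropy group of this point under the action of $G_{q_e}$ on $U$ is conjugate in $G_{q_e}$ to $H$. For $\lambda=\lambda_0$ its isotropy group, under the action of $G_{q_e}$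 on $U$ as well as under the action of $G$ on $Q$, is conjugate to $G_{q_e}$. -/

import Mathlib

open Bundle Set MulAction
open scoped Manifold ContDiff Topology

noncomputable section

namespace RelEq

/-! ### Geodesics and the Riemannian exponential map -/

section Riemannian

variable {E : Type*} [NormedAddCommGroup E] [NormedSpace ℝ E]
  {HQ : Type*} [TopologicalSpace HQ] (I : ModelWithCorners ℝ E HQ)
  {Q : Type*} [TopologicalSpace Q] [ChartedSpace HQ Q]
  [RiemannianBundle (fun q : Q ↦ TangentSpace I q)]

/-- The coefficients of the Riemannian metric in the chart `φ` around `x₀`: at a point `y` of the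
chart domain in `E`, the inner product of `Dφ⁻¹(y) a` and `Dφ⁻¹(y) b`. -/
def chartMetric (x₀ : Q) (y a b : E) : ℝ :=
  inner ℝ (mfderiv 𝓘(ℝ, E) I (extChartAt I x₀).symm y a : TangentSpace I ((extChartAt I x₀).symm y))
    (mfderiv 𝓘(ℝ, E) I (extChartAt I x₀).symm y b)

/-- The Christoffel symbols of the first kind of the Levi-Civita connection in the chart
around `x₀`: `Γ(a, b; w) = (∂_a g(b, w) + ∂_b g(a, w) - ∂_w g(a, b)) / 2`. -/
def christoffelFirst (x₀ : Q) (y a b w : E) : ℝ :=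
  (fderiv ℝ (fun z ↦ chartMetric I x₀ z b w) y a
    + fderiv ℝ (fun z ↦ chartMetric I x₀ z a w) y b
    - fderiv ℝ (fun z ↦ chartMetric I x₀ z a b) y w) / 2

/-- `c` is a geodesic on the open set `s` of times: it is smooth there and, in each chart, its
coordinate expression `u` satisfies `g(u'', w) + Γ(u', u'; w) = 0` for all `w`, which is the
equation `u'' + Γ(u', u') = 0` with its index lowered by the metric. -/
def IsGeodesicOn (c : ℝ → Q) (s : Set ℝ) : Prop :=
  ContMDiffOn 𝓘(ℝ, ℝ) I ∞ c s ∧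
  ∀ x₀ : Q, ∀ t ∈ s, c t ∈ (extChartAt I x₀).source →
    ∀ w : E,
      chartMetric I x₀ (extChartAt I x₀ (c t))
          (deriv (deriv (fun r ↦ extChartAt I x₀ (c r))) t) w
        + christoffelFirst I x₀ (extChartAt I x₀ (c t))
          (deriv (fun r ↦ extChartAt I x₀ (c r)) t)
          (deriv (fun r ↦ extChartAt I x₀ (c r)) t) w = 0

/-- `c` is a geodesic, defined on an open interval around `[0, 1]`, that starts at `q` with
initial velocity `v`. -/
def IsGeodesicFrom (q : Q) (v : TangentSpace I q) (c : ℝ → Q) : Prop :=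
  (∃ δ > 0, IsGeodesicOn I c (Ioo (-δ) (1 + δ))) ∧
  (⟨c 0, mfderiv 𝓘(ℝ, ℝ) I c 0 (1 : ℝ)⟩ : TangentBundle I Q) = ⟨q, v⟩

/-- The domain of the Riemannian exponential map at `q`. -/
def expDomain (q : Q) : Set (TangentSpace I q) :=
  {v | ∃ c : ℝ → Q, IsGeodesicFrom I q v c}

open Classical in
/-- The Riemannian exponential map at `q`: the value at time `1` of the geodesic that starts at `q`
with velocity `v`, if that geodesic exists up to time `1` (and `q` otherwise). -/
def Exp (q : Q) (v : TangentSpace I q) : Q :=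
  if h : ∃ c : ℝ → Q, IsGeodesicFrom I q v c then h.choose 1 else q

end Riemannian

/-! ### Group actions, equivariant vector fields and relative equilibria -/

section Action

variable {E : Type*} [NormedAddCommGroup E] [NormedSpace ℝ E]
  {HQ : Type*} [TopologicalSpace HQ] (I : ModelWithCorners ℝ E HQ)
  {Q : Type*} [TopologicalSpace Q] [ChartedSpace HQ Q]
  {F : Type*} [NormedAddCommGroup F] [NormedSpace ℝ F]
  {HG : Type*} [TopologicalSpace HG] (J : ModelWithCorners ℝ F HG)
  {G : Type*} [TopologicalSpace G] [ChartedSpace HG G] [Group G] [MulAction G Q]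

/-- The vector field `X` is smooth. -/
def IsSmoothVectorField [IsManifold I 1 Q] (X : Π q : Q, TangentSpace I q) : Prop :=
  ContMDiff I I.tangent ∞ (fun q ↦ (⟨q, X q⟩ : TangentBundle I Q))

variable (G) in
/-- `X` is `G`-equivariant: `T_q Φ_g (X q) = X (g • q)`. -/
def IsEquivariant (X : Π q : Q, TangentSpace I q) : Prop :=
  ∀ (g : G) (q : Q), mfderiv I I (fun x : Q ↦ g • x) q (X q) = X (g • q)

variable (G Q) in
/-- `G` acts by isometries of the Riemannian metric. -/
def ActsByIsometries [RiemannianBundle (fun q : Q ↦ TangentSpace I q)] : Prop :=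
  ∀ (g : G) (q : Q) (v w : TangentSpace I q),
    inner ℝ (mfderiv I I (fun x : Q ↦ g • x) q v) (mfderiv I I (fun x : Q ↦ g • x) q w)
      = inner ℝ v w

/-- `c` is the curve `t ↦ exp (t ξ)`: the smooth one-parameter subgroup of `G` with
velocity `ξ` at `t = 0`. -/
def IsExpCurve (ξ : GroupLieAlgebra J G) (c : ℝ → G) : Prop :=
  ContMDiff 𝓘(ℝ, ℝ) J ∞ c ∧ (∀ s t : ℝ, c (s + t) = c s * c t) ∧
  (⟨c 0, mfderiv 𝓘(ℝ, ℝ) J c 0 (1 : ℝ)⟩ : TangentBundle J G) = ⟨1, ξ⟩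

variable (G) in
/-- `q` is a relative equilibrium of `X`: for some `ξ` in the Lie algebra of `G`, the derivative
at `t = 0` of `exp (t ξ) • q` is `X q`. (Here `c 0 = 1`.) -/
def IsRelativeEquilibrium (X : Π q : Q, TangentSpace I q) (q : Q) : Prop :=
  ∃ (ξ : GroupLieAlgebra J G) (c : ℝ → G), IsExpCurve J ξ c ∧
    HasMFDerivAt 𝓘(ℝ, ℝ) I (fun t : ℝ ↦ c t • q) 0
      ((1 : ℝ →L[ℝ] ℝ).smulRight (X (c 0 • q)))

/-- The linear action `h · v = T_q Φ_h v` of the isotropy group `G_q` on `T_q Q`. As `h • q = q`,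
the value, an element of `T_{h • q} Q`, is an element of `T_q Q`. -/
def tangentAction {q : Q} (h : stabilizer G q) (v : TangentSpace I q) : TangentSpace I q :=
  (mfderiv I I (fun x : Q ↦ (h : G) • x) q v : TangentSpace I ((h : G) • q))

variable (G) in
/-- The isotropy group of `v ∈ T_q Q` under the linear action of `G_q`. -/
def tangentIsotropy {q : Q} (v : TangentSpace I q) : Set (stabilizer G q) :=
  {h | tangentAction I h v = v}

variable (G) in
/-- `v ∈ T_q Q` is a relative equilibrium, for the linear action of `G_q` on `T_q Q`, of the vector
field `Y`: for some `ξ` in the Lie algebra of `G_q` (that is, `exp (t ξ) ∈ G_q` for all `t`), the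
derivative at `t = 0` of `exp (t ξ) · v` is `Y v`. -/
def IsTangentRelativeEquilibrium
    (q : Q) (Y : TangentSpace I q → TangentSpace I q) (v : TangentSpace I q) : Prop :=
  ∃ (ξ : GroupLieAlgebra J G) (c : ℝ → stabilizer G q), IsExpCurve J ξ (fun t ↦ (c t : G)) ∧
    HasDerivAt (fun t : ℝ ↦ tangentAction I (c t) v) (Y v) 0

/-- The set `S` is a subgroup conjugate to `H` in `Γ`. -/
def IsConjugateTo {Γ : Type*} [Group Γ] (S : Set Γ) (H : Subgroup Γ) : Prop :=
  ∃ g : Γ, S = (H.map (MulAut.conj g).toMonoidHom : Set Γ)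

variable (G) in
/-- `V` is a `G_q`-invariant open neighbourhood of `0` in `T_q Q`, inside the domain of the
Riemannian exponential map at `q`, which maps `V` diffeomorphically onto an open subset of `Q`. -/
structure IsExpNeighborhood [RiemannianBundle (fun q : Q ↦ TangentSpace I q)]
    (q : Q) (V : Set (TangentSpace I q)) : Prop where
  isOpen : IsOpen V
  zero_mem : (0 : TangentSpace I q) ∈ V
  invariant : ∀ (h : stabilizer G q), ∀ v ∈ V, tangentAction I h v ∈ V
  subset_domain : V ⊆ expDomain I q
  injOn : InjOn (Exp I q) V
  isOpen_image : IsOpen (Exp I q '' V)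
  smooth : ContMDiffOn 𝓘(ℝ, TangentSpace I q) I ∞ (Exp I q) V
  smooth_inverse : ∃ Log : Q → TangentSpace I q, LeftInvOn Log (Exp I q) V ∧
    ContMDiffOn I 𝓘(ℝ, TangentSpace I q) ∞ Log (Exp I q '' V)

/-- The pullback `Exp_q^* X`, a vector field on the part of `T_q Q` where `Exp_q` is a local
diffeomorphism: `v ↦ (T_v Exp_q)⁻¹ (X (Exp_q v))`. -/
def expPullback [RiemannianBundle (fun q : Q ↦ TangentSpace I q)]
    (q : Q) (X : Π q : Q, TangentSpace I q) (v : TangentSpace I q) : TangentSpace I q :=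
  VectorField.mpullback 𝓘(ℝ, TangentSpace I q) I (Exp I q) X v

end Action

end RelEq

end

/-!
In charts, an isometry pulls the metric back to itself, so by the transformation law of the
Christoffel symbols it carries solutions of the geodesic equation to solutions. Since geodesics are
determined by their initial velocity, an isometry `f` satisfies `Exp_{f q} (T_q f v) = f (Exp_q v)`;
for `h` in the isotropy group of `q` this says that `Exp_q` intertwines the linear action of `h`
with its action on `Q`. As `Exp_q` is injective on `V`, the isotropy groups of `v` and `Exp_q v`
agree, and applying `Exp_q` to the curve `exp (t ξ) · v` turns relative equilibria of the pullback
into relative equilibria of `X`, because `T_v Exp_q` maps the pulled back field to `X (Exp_q v)`.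
-/

noncomputable section

namespace RelEq

set_option maxSynthPendingDepth 3

section Coordinates

variable {E E' : Type*} [NormedAddCommGroup E] [NormedSpace ℝ E]
  [NormedAddCommGroup E'] [NormedSpace ℝ E']

/-- The covector `Γ(p, p; ·)` at `y`, where `Γ` are the Christoffel symbols of the first kind of the
field `g` of bilinear forms; the geodesic equation only involves this quadratic part of `Γ`. -/
def christoffelCovector (g : E → E →L[ℝ] E →L[ℝ] ℝ) (y p : E) : E →L[ℝ] ℝ :=
  fderiv ℝ g y p p -
    (2⁻¹ : ℝ) • (ContinuousLinearMap.apply ℝ ℝ p ∘L ContinuousLinearMap.apply ℝ (E →L[ℝ] ℝ) p) ∘L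
      fderiv ℝ g y

theorem christoffelCovector_apply (g : E → E →L[ℝ] E →L[ℝ] ℝ) (y p w : E) :
    christoffelCovector g y p w = fderiv ℝ g y p p w - 2⁻¹ * fderiv ℝ g y w p p :=
  rfl

/-- The curve `u` satisfies the geodesic equation of `g` at time `t`, as an equation between
covectors: `g(u'', ·) + Γ(u', u'; ·) = 0`. -/
def SatisfiesGeodesicEquation (g : E → E →L[ℝ] E →L[ℝ] ℝ) (u : ℝ → E) (t : ℝ) : Prop :=
  g (u t) (deriv (deriv u) t) + christoffelCovector g (u t) (deriv u t) = 0

theorem satisfiesGeodesicEquation_iff {g : E → E →L[ℝ] E →L[ℝ] ℝ} {u : ℝ → E} {t : ℝ} :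
    SatisfiesGeodesicEquation g u t ↔
      ∀ w, g (u t) (deriv (deriv u) t) w + christoffelCovector g (u t) (deriv u t) w = 0 :=
  ContinuousLinearMap.ext_iff

theorem SatisfiesGeodesicEquation.congr {g : E → E →L[ℝ] E →L[ℝ] ℝ} {u v : ℝ → E} {t : ℝ}
    (hu : SatisfiesGeodesicEquation g u t) (huv : u =ᶠ[𝓝 t] v) :
    SatisfiesGeodesicEquation g v t := by
  rw [SatisfiesGeodesicEquation, ← huv.deriv.deriv_eq, ← huv.deriv_eq, ← huv.self_of_nhds]
  exact hu

theorem fderiv_pullback_form_apply {g : E → E →L[ℝ] E →L[ℝ] ℝ} {g' : E' → E' →L[ℝ] E' →L[ℝ] ℝ}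
    {ψ : E → E'} {y : E} (hψ : ContDiffAt ℝ 2 ψ y) (hg : DifferentiableAt ℝ g y)
    (hg' : DifferentiableAt ℝ g' (ψ y))
    (hpull : ∀ᶠ z in 𝓝 y, ∀ a b, g z a b = g' (ψ z) (fderiv ℝ ψ z a) (fderiv ℝ ψ z b))
    (c a b : E) :
    fderiv ℝ g y c a b =
      fderiv ℝ g' (ψ y) (fderiv ℝ ψ y c) (fderiv ℝ ψ y a) (fderiv ℝ ψ y b)
        + g' (ψ y) (fderiv ℝ (fderiv ℝ ψ) y c a) (fderiv ℝ ψ y b)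
        + g' (ψ y) (fderiv ℝ ψ y a) (fderiv ℝ (fderiv ℝ ψ) y c b) := by
  have hψ₁ : HasFDerivAt ψ (fderiv ℝ ψ y) y := (hψ.differentiableAt (by norm_num)).hasFDerivAt
  have hψ₂ : HasFDerivAt (fderiv ℝ ψ) (fderiv ℝ (fderiv ℝ ψ) y) y :=
    ((hψ.fderiv_right (m := 1) (by norm_num)).differentiableAt (by norm_num)).hasFDerivAt
  have hconst (v : E) : HasFDerivAt (fun _ : E ↦ v) (0 : E →L[ℝ] E) y := hasFDerivAt_const v y
  have hleft : HasFDerivAt (fun z ↦ g z a b) _ y :=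
    (hg.hasFDerivAt.clm_apply (hconst a)).clm_apply (hconst b)
  have hright : HasFDerivAt (fun z ↦ g z a b) _ y :=
    (((hg'.hasFDerivAt.comp y hψ₁).clm_apply (hψ₂.clm_apply (hconst a))).clm_apply
      (hψ₂.clm_apply (hconst b))).congr_of_eventuallyEq (hpull.mono fun z hz ↦ hz a b)
  have hc := congrArg (fun L : E →L[ℝ] ℝ ↦ L c) (hleft.unique hright)
  simp only [ContinuousLinearMap.comp_zero, zero_add, ContinuousLinearMap.flip_apply,
    Function.comp_apply, ContinuousLinearMap.flip_add, add_apply,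
    ContinuousLinearMap.comp_apply] at hc
  rw [hc]
  ring

/-- Transformation law of the Christoffel symbols: the second derivative of `ψ` enters only through
`ψ''(p, p)`, because `ψ''` is symmetric. -/
theorem christoffelCovector_pullback_apply {g : E → E →L[ℝ] E →L[ℝ] ℝ}
    {g' : E' → E' →L[ℝ] E' →L[ℝ] ℝ} {ψ : E → E'} {y : E} (hψ : ContDiffAt ℝ 2 ψ y)
    (hg : DifferentiableAt ℝ g y) (hg' : DifferentiableAt ℝ g' (ψ y))
    (hsymm : ∀ a b, g' (ψ y) a b = g' (ψ y) b a)
    (hpull : ∀ᶠ z in 𝓝 y, ∀ a b, g z a b = g' (ψ z) (fderiv ℝ ψ z a) (fderiv ℝ ψ z b)) (p w : E) :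
    christoffelCovector g y p w = christoffelCovector g' (ψ y) (fderiv ℝ ψ y p) (fderiv ℝ ψ y w)
      + g' (ψ y) (fderiv ℝ (fderiv ℝ ψ) y p p) (fderiv ℝ ψ y w) := by
  have hψsymm : IsSymmSndFDerivAt ℝ ψ y := hψ.isSymmSndFDerivAt (by simp)
  simp only [christoffelCovector_apply, fderiv_pullback_form_apply hψ hg hg' hpull]
  rw [hψsymm.eq w p, hsymm (fderiv ℝ (fderiv ℝ ψ) y p w)]
  ring

theorem contDiffAt_deriv {u : ℝ → E} {t : ℝ} (hu : ContDiffAt ℝ 2 u t) :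
    ContDiffAt ℝ 1 (deriv u) t :=
  hu.derivWithin one_add_one_eq_two.le

theorem deriv_comp_eventuallyEq {ψ : E → E'} {u : ℝ → E} {t : ℝ} (hu : ContDiffAt ℝ 1 u t)
    (hψ : ContDiffAt ℝ 1 ψ (u t)) :
    deriv (ψ ∘ u) =ᶠ[𝓝 t] fun r ↦ fderiv ℝ ψ (u r) (deriv u r) := by
  filter_upwards [hu.eventually (by simp), hu.continuousAt.eventually (hψ.eventually (by simp))]
    with r hur hψr
  exact ((hψr.differentiableAt one_ne_zero).hasFDerivAt.comp_hasDerivAt r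
    (hur.differentiableAt one_ne_zero).hasDerivAt).deriv

theorem deriv_deriv_comp {ψ : E → E'} {u : ℝ → E} {t : ℝ} (hu : ContDiffAt ℝ 2 u t)
    (hψ : ContDiffAt ℝ 2 ψ (u t)) :
    deriv (deriv (ψ ∘ u)) t =
      fderiv ℝ (fderiv ℝ ψ) (u t) (deriv u t) (deriv u t)
        + fderiv ℝ ψ (u t) (deriv (deriv u) t) := by
  have hu₁ : HasDerivAt u (deriv u t) t := (hu.differentiableAt two_ne_zero).hasDerivAt
  have hu₂ : HasDerivAt (deriv u) (deriv (deriv u) t) t :=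
    ((contDiffAt_deriv hu).differentiableAt one_ne_zero).hasDerivAt
  have hψ₂ : HasFDerivAt (fderiv ℝ ψ) (fderiv ℝ (fderiv ℝ ψ) (u t)) (u t) :=
    ((hψ.fderiv_right (m := 1) (by norm_num)).differentiableAt one_ne_zero).hasFDerivAt
  rw [(deriv_comp_eventuallyEq (hu.of_le one_le_two) (hψ.of_le one_le_two)).deriv_eq]
  exact ((hψ₂.comp_hasDerivAt t hu₁).clm_apply hu₂).deriv

theorem SatisfiesGeodesicEquation.comp {g : E → E →L[ℝ] E →L[ℝ] ℝ}
    {g' : E' → E' →L[ℝ] E' →L[ℝ] ℝ} {ψ : E → E'} {u : ℝ → E} {t : ℝ}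
    (hgeo : SatisfiesGeodesicEquation g u t) (hu : ContDiffAt ℝ 2 u t)
    (hψ : ContDiffAt ℝ 2 ψ (u t)) (hsurj : Function.Surjective (fderiv ℝ ψ (u t)))
    (hg : DifferentiableAt ℝ g (u t)) (hg' : DifferentiableAt ℝ g' (ψ (u t)))
    (hsymm : ∀ a b, g' (ψ (u t)) a b = g' (ψ (u t)) b a)
    (hpull : ∀ᶠ z in 𝓝 (u t), ∀ a b, g z a b = g' (ψ z) (fderiv ℝ ψ z a) (fderiv ℝ ψ z b)) :
    SatisfiesGeodesicEquation g' (ψ ∘ u) t := by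
  refine satisfiesGeodesicEquation_iff.2 fun w' ↦ ?_
  obtain ⟨w, rfl⟩ := hsurj w'
  have hgeo_w := satisfiesGeodesicEquation_iff.1 hgeo w
  rw [christoffelCovector_pullback_apply hψ hg hg' hsymm hpull, hpull.self_of_nhds] at hgeo_w
  rw [deriv_deriv_comp hu hψ,
    (deriv_comp_eventuallyEq (hu.of_le one_le_two) (hψ.of_le one_le_two)).self_of_nhds]
  simp only [Function.comp_apply, map_add, add_apply]
  linarith

/-- The acceleration of a geodesic of `g` as a function of its position and velocity. -/
def geodesicAcceleration (g : E → E →L[ℝ] E →L[ℝ] ℝ) (z : E × E) : E :=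
  -(g z.1).inverse (christoffelCovector g z.1 z.2)

theorem SatisfiesGeodesicEquation.deriv_deriv_eq {g : E → E →L[ℝ] E →L[ℝ] ℝ} {u : ℝ → E} {t : ℝ}
    (hgeo : SatisfiesGeodesicEquation g u t) (hinv : (g (u t)).IsInvertible) :
    deriv (deriv u) t = geodesicAcceleration g (u t, deriv u t) := by
  rw [geodesicAcceleration, ← map_neg, ← eq_neg_of_add_eq_zero_left hgeo, hinv.inverse_apply_self]

theorem contDiffAt_christoffelCovector {g : E → E →L[ℝ] E →L[ℝ] ℝ} {z : E × E}
    (hg : ContDiffAt ℝ 2 g z.1) :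
    ContDiffAt ℝ 1 (fun z : E × E ↦ christoffelCovector g z.1 z.2) z := by
  have hD : ContDiffAt ℝ 1 (fun z : E × E ↦ fderiv ℝ g z.1) z :=
    (hg.fderiv_right (m := 1) (by norm_num)).comp z contDiffAt_fst
  have heval₁ : ContDiffAt ℝ 1 (fun z : E × E ↦ ContinuousLinearMap.apply ℝ ℝ z.2) z :=
    (ContinuousLinearMap.apply ℝ ℝ).contDiff.contDiffAt.comp z contDiffAt_snd
  have heval₂ : ContDiffAt ℝ 1 (fun z : E × E ↦ ContinuousLinearMap.apply ℝ (E →L[ℝ] ℝ) z.2) z :=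
    (ContinuousLinearMap.apply ℝ (E →L[ℝ] ℝ)).contDiff.contDiffAt.comp z contDiffAt_snd
  exact ((hD.clm_apply contDiffAt_snd).clm_apply contDiffAt_snd).sub
    (((heval₁.clm_comp heval₂).clm_comp hD).const_smul _)

theorem contDiffAt_geodesicAcceleration [CompleteSpace E] {g : E → E →L[ℝ] E →L[ℝ] ℝ} {z : E × E}
    (hg : ContDiffAt ℝ 2 g z.1) (hinv : (g z.1).IsInvertible) :
    ContDiffAt ℝ 1 (geodesicAcceleration g) z := by
  have hinverse : ContDiffAt ℝ 1 (fun z : E × E ↦ (g z.1).inverse) z :=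
    ContDiffAt.comp z (g := ContinuousLinearMap.inverse) hinv.contDiffAt_map_inverse
      ((hg.of_le one_le_two).comp z contDiffAt_fst)
  exact (hinverse.clm_apply (contDiffAt_christoffelCovector hg)).neg

theorem SatisfiesGeodesicEquation.hasDerivAt_phase {g : E → E →L[ℝ] E →L[ℝ] ℝ} {u : ℝ → E} {t : ℝ}
    (hgeo : SatisfiesGeodesicEquation g u t) (hu : ContDiffAt ℝ 2 u t)
    (hinv : (g (u t)).IsInvertible) :
    HasDerivAt (fun r ↦ (u r, deriv u r))
      (deriv u t, geodesicAcceleration g (u t, deriv u t)) t := by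
  rw [← hgeo.deriv_deriv_eq hinv]
  exact (hu.differentiableAt two_ne_zero).hasDerivAt.prodMk
    ((contDiffAt_deriv hu).differentiableAt one_ne_zero).hasDerivAt

theorem eventuallyEq_of_satisfiesGeodesicEquation [CompleteSpace E] {g : E → E →L[ℝ] E →L[ℝ] ℝ}
    {u₁ u₂ : ℝ → E} {t : ℝ} (hg : ContDiffAt ℝ 2 g (u₁ t))
    (hinv : ∀ᶠ y in 𝓝 (u₁ t), (g y).IsInvertible)
    (hu₁ : ContDiffAt ℝ 2 u₁ t) (hu₂ : ContDiffAt ℝ 2 u₂ t)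
    (hgeo₁ : ∀ᶠ r in 𝓝 t, SatisfiesGeodesicEquation g u₁ r)
    (hgeo₂ : ∀ᶠ r in 𝓝 t, SatisfiesGeodesicEquation g u₂ r)
    (heq : u₁ t = u₂ t) (hderiv : deriv u₁ t = deriv u₂ t) : u₁ =ᶠ[𝓝 t] u₂ := by
  obtain ⟨K, s, hs, hlip⟩ := ((contDiffAt_snd (𝕜 := ℝ) (n := 1)).prodMk
    (contDiffAt_geodesicAcceleration (z := (u₁ t, deriv u₁ t)) hg
      hinv.self_of_nhds)).exists_lipschitzOnWith
  have hphase (u : ℝ → E) (hu : ContDiffAt ℝ 2 u t)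
      (hgeo : ∀ᶠ r in 𝓝 t, SatisfiesGeodesicEquation g u r)
      (hut : u₁ t = u t) (hut' : deriv u₁ t = deriv u t) :
      ∀ᶠ r in 𝓝 t, HasDerivAt (fun r ↦ (u r, deriv u r))
        (deriv u r, geodesicAcceleration g (u r, deriv u r)) r ∧ (u r, deriv u r) ∈ s := by
    rw [hut, hut'] at hs
    rw [hut] at hinv
    filter_upwards [hgeo, hu.eventually (by simp), hu.continuousAt.eventually hinv,
      (hu.continuousAt.prodMk (contDiffAt_deriv hu).continuousAt).eventually_mem hs]
      with r hgeo_r hu_r hinv_r hmem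
    exact ⟨hgeo_r.hasDerivAt_phase hu_r hinv_r, hmem⟩
  exact (ODE_solution_unique_of_eventually (s := fun _ ↦ s)
    (v := fun _ z ↦ (z.2, geodesicAcceleration g z)) (.of_forall fun _ ↦ hlip)
    (hphase u₁ hu₁ hgeo₁ rfl rfl) (hphase u₂ hu₂ hgeo₂ heq hderiv)
    (by rw [heq, hderiv])).mono fun _ hr ↦ congrArg Prod.fst hr

end Coordinates

section ChartDerivative

variable {E : Type*} [NormedAddCommGroup E] [NormedSpace ℝ E]
  {HQ : Type*} [TopologicalSpace HQ] {I : ModelWithCorners ℝ E HQ} [I.Boundaryless]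
  {Q : Type*} [TopologicalSpace Q] [ChartedSpace HQ Q] [IsManifold I ∞ Q] {x₀ : Q} {y : E}

theorem contMDiffAt_extChartAt_symm (hy : y ∈ (extChartAt I x₀).target) :
    ContMDiffAt 𝓘(ℝ, E) I ∞ (extChartAt I x₀).symm y :=
  (contMDiffOn_extChartAt_symm x₀).contMDiffAt ((isOpen_extChartAt_target x₀).mem_nhds hy)

theorem symmL_eq_mfderiv_extChartAt_symm (hy : y ∈ (extChartAt I x₀).target) :
    (trivializationAt E (TangentSpace I) x₀).symmL ℝ ((extChartAt I x₀).symm y) =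
      mfderiv 𝓘(ℝ, E) I (extChartAt I x₀).symm y := by
  have hx : (extChartAt I x₀).symm y ∈ (chartAt HQ x₀).source := by
    simpa only [extChartAt_source] using (extChartAt I x₀).map_target hy
  rw [TangentBundle.symmL_trivializationAt hx, I.range_eq_univ, mfderivWithin_univ,
    (extChartAt I x₀).right_inv hy]

theorem isInvertible_mfderiv_extChartAt_symm (hy : y ∈ (extChartAt I x₀).target) :
    (mfderiv 𝓘(ℝ, E) I (extChartAt I x₀).symm y).IsInvertible := by
  simpa only [I.range_eq_univ, mfderivWithin_univ] using
    isInvertible_mfderivWithin_extChartAt_symm hy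

end ChartDerivative

section PullbackMetric

variable {E' : Type*} [NormedAddCommGroup E'] [NormedSpace ℝ E']
  {H' : Type*} [TopologicalSpace H'] {I' : ModelWithCorners ℝ E' H'}
  {M' : Type*} [TopologicalSpace M'] [ChartedSpace H' M']
  {E'' : Type*} [NormedAddCommGroup E''] [NormedSpace ℝ E'']
  {H'' : Type*} [TopologicalSpace H''] {I'' : ModelWithCorners ℝ E'' H''}
  {M'' : Type*} [TopologicalSpace M''] [ChartedSpace H'' M'']
  {E : Type*} [NormedAddCommGroup E] [NormedSpace ℝ E]
  {HQ : Type*} [TopologicalSpace HQ] {I : ModelWithCorners ℝ E HQ}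
  {Q : Type*} [TopologicalSpace Q] [ChartedSpace HQ Q]
  [RiemannianBundle (fun q : Q ↦ TangentSpace I q)]

variable (I' I) in
/-- The pullback of the Riemannian metric of `Q` along `f : M' → Q`, evaluated on two tangent
vectors at `x`. -/
def pullbackMetric (f : M' → Q) (x : M') (a b : TangentSpace I' x) : ℝ :=
  inner ℝ (mfderiv I' I f x a) (mfderiv I' I f x b)

theorem pullbackMetric_congr {f f' : M' → Q} {x : M'} (h : f =ᶠ[𝓝 x] f')
    (a b : TangentSpace I' x) : pullbackMetric I' I f x a b = pullbackMetric I' I f' x a b := by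
  have inner_congr {q q' : Q} (hq : q = q') (a b : E) :
      inner ℝ (show TangentSpace I q from a) b = inner ℝ (show TangentSpace I q' from a) b := by
    subst hq; rfl
  unfold pullbackMetric
  rw [h.mfderiv_eq]
  exact inner_congr h.self_of_nhds _ _

theorem pullbackMetric_comp {f : M' → Q} {ψ : M'' → M'} {x : M''}
    (hf : MDifferentiableAt I' I f (ψ x)) (hψ : MDifferentiableAt I'' I' ψ x)
    (a b : TangentSpace I'' x) :
    pullbackMetric I'' I (f ∘ ψ) x a b =
      pullbackMetric I' I f (ψ x) (mfderiv I'' I' ψ x a) (mfderiv I'' I' ψ x b) := by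
  unfold pullbackMetric
  rw [mfderiv_comp x hf hψ]
  rfl

end PullbackMetric

theorem isInvertible_bilinearComp_innerSL {E F : Type*} [NormedAddCommGroup E] [NormedSpace ℝ E]
    [CompleteSpace E] [NormedAddCommGroup F] [InnerProductSpace ℝ F] (L : E ≃L[ℝ] F) :
    ((innerSL ℝ (E := F)).bilinearComp (L : E →L[ℝ] F) (L : E →L[ℝ] F)).IsInvertible := by
  have : CompleteSpace F := (completeSpace_congr (e := L.toEquiv) L.isUniformEmbedding).1 ‹_›
  refine ⟨.ofBijective _ (LinearMap.ker_eq_bot'.2 fun a ha ↦ ?_)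
    (LinearMap.range_eq_top.2 fun ℓ ↦ ?_), ContinuousLinearEquiv.coe_ofBijective ..⟩
  · have haa : inner ℝ (L a) (L a) = 0 := DFunLike.congr_fun ha a
    simpa using haa
  · refine ⟨L.symm ((InnerProductSpace.toDual ℝ F).symm (ℓ ∘L L.symm)), ?_⟩
    ext b
    simp

section ChartForm

variable {E : Type*} [NormedAddCommGroup E] [NormedSpace ℝ E]
  {HQ : Type*} [TopologicalSpace HQ] (I : ModelWithCorners ℝ E HQ)
  {Q : Type*} [TopologicalSpace Q] [ChartedSpace HQ Q]
  [RiemannianBundle (fun q : Q ↦ TangentSpace I q)]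

/-- The coefficients of the metric in the chart around `x₀`, bundled as a field of continuous
bilinear forms, so that they can be differentiated in the operator norm. -/
def chartForm (x₀ : Q) (y : E) : E →L[ℝ] E →L[ℝ] ℝ :=
  (innerSL ℝ (E := TangentSpace I ((extChartAt I x₀).symm y))).bilinearComp
    (mfderiv 𝓘(ℝ, E) I (extChartAt I x₀).symm y) (mfderiv 𝓘(ℝ, E) I (extChartAt I x₀).symm y)

theorem chartForm_comm (x₀ : Q) (y a b : E) : chartForm I x₀ y a b = chartForm I x₀ y b a :=
  real_inner_comm (F := TangentSpace I ((extChartAt I x₀).symm y)) _ _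

section Regularity

variable [I.Boundaryless] [IsManifold I ∞ Q] {x₀ : Q} {y : E}

theorem isInvertible_chartForm [CompleteSpace E] (hy : y ∈ (extChartAt I x₀).target) :
    (chartForm I x₀ y).IsInvertible := by
  obtain ⟨L, hL⟩ := isInvertible_mfderiv_extChartAt_symm hy
  rw [chartForm, ← hL]
  exact isInvertible_bilinearComp_innerSL (E := E) L

theorem contDiffAt_chartForm [IsContMDiffRiemannianBundle I ∞ E (fun q : Q ↦ TangentSpace I q)]
    (hy : y ∈ (extChartAt I x₀).target) : ContDiffAt ℝ ∞ (chartForm I x₀) y := by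
  obtain ⟨g, hg, hinner⟩ := IsContMDiffRiemannianBundle.exists_contMDiff (IB := I) (n := ∞) (F := E)
    (E := fun q : Q ↦ TangentSpace I q)
  have hbase {z : E} (hz : z ∈ (extChartAt I x₀).target) :
      (extChartAt I x₀).symm z ∈ (trivializationAt E (TangentSpace I) x₀).baseSet := by
    simpa using (extChartAt I x₀).map_target hz
  have hcoord : ContMDiffAt I 𝓘(ℝ, E →L[ℝ] E →L[ℝ] ℝ) ∞ (fun q ↦ (trivializationAt
      (E →L[ℝ] E →L[ℝ] ℝ) (fun q : Q ↦ TangentSpace I q →L[ℝ] TangentSpace I q →L[ℝ] ℝ) x₀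
        ⟨q, g q⟩).2) ((extChartAt I x₀).symm y) :=
    (Trivialization.contMDiffAt_section_iff _ (by simpa using hbase hy)).1 hg.contMDiffAt
  refine (hcoord.comp y (contMDiffAt_extChartAt_symm hy)).contDiffAt.congr_of_eventuallyEq ?_
  filter_upwards [(isOpen_extChartAt_target x₀).mem_nhds hy] with z hz
  ext a b
  rw [Function.comp_apply, hom_trivializationAt_apply,
    inCoordinates_apply_eq₂ (hbase hz) (hbase hz) (mem_univ _), ← hinner,
    ← Trivialization.symmL_apply (R := ℝ) _ (hbase hz),
    ← Trivialization.symmL_apply (R := ℝ) _ (hbase hz), symmL_eq_mfderiv_extChartAt_symm hz]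
  simp only [Trivial.fiberBundle_trivializationAt', Trivial.linearMapAt_trivialization]
  rfl

variable [IsContMDiffRiemannianBundle I ∞ E (fun q : Q ↦ TangentSpace I q)]

theorem christoffelFirst_self_eq_christoffelCovector (hy : y ∈ (extChartAt I x₀).target)
    (p w : E) : christoffelFirst I x₀ y p p w = christoffelCovector (chartForm I x₀) y p w := by
  have hform : HasFDerivAt (chartForm I x₀) (fderiv ℝ (chartForm I x₀) y) y :=
    ((contDiffAt_chartForm I hy).differentiableAt (by simp)).hasFDerivAt
  have hcoeff (a b c : E) :
      fderiv ℝ (fun z ↦ chartMetric I x₀ z a b) y c = fderiv ℝ (chartForm I x₀) y c a b := by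
    have := (hform.clm_apply (hasFDerivAt_const a y)).clm_apply (hasFDerivAt_const b y)
    rw [show (fun z ↦ chartMetric I x₀ z a b) = fun z ↦ chartForm I x₀ z a b from rfl, this.fderiv]
    simp
  simp only [christoffelFirst, christoffelCovector_apply, hcoeff]
  ring

theorem isGeodesicOn_iff_satisfiesGeodesicEquation {c : ℝ → Q} {s : Set ℝ} :
    IsGeodesicOn I c s ↔ ContMDiffOn 𝓘(ℝ, ℝ) I ∞ c s ∧
      ∀ x₀ : Q, ∀ t ∈ s, c t ∈ (extChartAt I x₀).source →
        SatisfiesGeodesicEquation (chartForm I x₀) (extChartAt I x₀ ∘ c) t := by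
  refine and_congr_right fun _ ↦ forall_congr' fun x₀ ↦ forall₂_congr fun t _ ↦
    forall_congr' fun hct ↦ ?_
  simp only [christoffelFirst_self_eq_christoffelCovector I ((extChartAt I x₀).map_source hct)]
  exact (satisfiesGeodesicEquation_iff (g := chartForm I x₀) (u := extChartAt I x₀ ∘ c)).symm

end Regularity

end ChartForm
section LocalIsometry

variable {E : Type*} [NormedAddCommGroup E] [NormedSpace ℝ E]
  {HQ : Type*} [TopologicalSpace HQ] (I : ModelWithCorners ℝ E HQ)
  {Q : Type*} [TopologicalSpace Q] [ChartedSpace HQ Q]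
  {E' : Type*} [NormedAddCommGroup E'] [NormedSpace ℝ E']
  {HQ' : Type*} [TopologicalSpace HQ'] (I' : ModelWithCorners ℝ E' HQ')
  {Q' : Type*} [TopologicalSpace Q'] [ChartedSpace HQ' Q']

/-- The expression of `f` in the charts around `x₀` and `x₁`. -/
def chartExpression (f : Q → Q') (x₀ : Q) (x₁ : Q') : E → E' :=
  extChartAt I' x₁ ∘ f ∘ (extChartAt I x₀).symm

/-- `f` is a smooth map whose derivatives are surjective linear isometries. -/
structure IsRiemannianLocalIsometry [RiemannianBundle (fun q : Q ↦ TangentSpace I q)]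
    [RiemannianBundle (fun q : Q' ↦ TangentSpace I' q)] (f : Q → Q') : Prop where
  contMDiff : ContMDiff I I' ∞ f
  inner_mfderiv : ∀ (x : Q) (v w : TangentSpace I x),
    inner ℝ (mfderiv I I' f x v) (mfderiv I I' f x w) = inner ℝ v w
  surjective_mfderiv : ∀ x : Q, Function.Surjective (mfderiv I I' f x)

variable {I I'}

section ChartExpression

variable [I.Boundaryless] {f : Q → Q'} {x₀ : Q} {x₁ : Q'} {y : E}

theorem eventually_mem_chartExpression_domain (hf : Continuous f)
    (hy : y ∈ (extChartAt I x₀).target)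
    (hfy : f ((extChartAt I x₀).symm y) ∈ (extChartAt I' x₁).source) :
    ∀ᶠ z in 𝓝 y, z ∈ (extChartAt I x₀).target ∧
      f ((extChartAt I x₀).symm z) ∈ (extChartAt I' x₁).source :=
  ((isOpen_extChartAt_target x₀).eventually_mem hy).and
    ((hf.continuousAt.comp (continuousAt_extChartAt_symm'' hy)).eventually_mem
      ((isOpen_extChartAt_source x₁).mem_nhds hfy))

variable [IsManifold I ∞ Q] [IsManifold I' ∞ Q']

theorem contDiffAt_chartExpression (hf : ContMDiff I I' ∞ f) (hy : y ∈ (extChartAt I x₀).target)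
    (hfy : f ((extChartAt I x₀).symm y) ∈ (extChartAt I' x₁).source) :
    ContDiffAt ℝ ∞ (chartExpression I I' f x₀ x₁) y := by
  rw [← contMDiffAt_iff_contDiffAt]
  rw [extChartAt_source] at hfy
  exact (contMDiffAt_extChartAt' hfy).comp y
    (hf.contMDiffAt.comp y (contMDiffAt_extChartAt_symm hy))

theorem surjective_fderiv_chartExpression (hf : ContMDiff I I' ∞ f)
    (hy : y ∈ (extChartAt I x₀).target)
    (hfy : f ((extChartAt I x₀).symm y) ∈ (extChartAt I' x₁).source)
    (hsurj : Function.Surjective (mfderiv I I' f ((extChartAt I x₀).symm y))) :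
    Function.Surjective (fderiv ℝ (chartExpression I I' f x₀ x₁) y) := by
  have hchart : MDifferentiableAt I' 𝓘(ℝ, E') (extChartAt I' x₁) (f ((extChartAt I x₀).symm y)) :=
    mdifferentiableAt_extChartAt (by rwa [← extChartAt_source I'])
  have hf' : MDifferentiableAt I I' f ((extChartAt I x₀).symm y) := hf.mdifferentiableAt (by simp)
  have hsymm : MDifferentiableAt 𝓘(ℝ, E) I (extChartAt I x₀).symm y :=
    (contMDiffAt_extChartAt_symm hy).mdifferentiableAt (by simp)
  rw [← mfderiv_eq_fderiv, chartExpression, mfderiv_comp y hchart (hf'.comp y hsymm),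
    mfderiv_comp y hf' hsymm]
  exact (isInvertible_mfderiv_extChartAt hfy).surjective.comp
    (hsurj.comp (isInvertible_mfderiv_extChartAt_symm hy).surjective)

end ChartExpression

namespace IsRiemannianLocalIsometry

variable [RiemannianBundle (fun q : Q ↦ TangentSpace I q)]
  [RiemannianBundle (fun q : Q' ↦ TangentSpace I' q)] {f : Q → Q'}

theorem pullbackMetric_comp {E'' : Type*} [NormedAddCommGroup E''] [NormedSpace ℝ E'']
    {H'' : Type*} [TopologicalSpace H''] {I'' : ModelWithCorners ℝ E'' H''}
    {M'' : Type*} [TopologicalSpace M''] [ChartedSpace H'' M'']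
    (hf : IsRiemannianLocalIsometry I I' f) {ψ : M'' → Q} {x : M''}
    (hψ : MDifferentiableAt I'' I ψ x) (a b : TangentSpace I'' x) :
    pullbackMetric I'' I' (f ∘ ψ) x a b = pullbackMetric I'' I ψ x a b := by
  rw [RelEq.pullbackMetric_comp (hf.contMDiff.mdifferentiableAt (by simp)) hψ]
  exact hf.inner_mfderiv (ψ x) _ _

variable [I.Boundaryless] [IsManifold I ∞ Q] [I'.Boundaryless] [IsManifold I' ∞ Q'] {x₀ : Q}
  {x₁ : Q'} {y : E}

theorem chartMetric_chartExpression (hf : IsRiemannianLocalIsometry I I' f)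
    (hy : y ∈ (extChartAt I x₀).target)
    (hfy : f ((extChartAt I x₀).symm y) ∈ (extChartAt I' x₁).source) (a b : E) :
    chartMetric I' x₁ (chartExpression I I' f x₀ x₁ y)
        (fderiv ℝ (chartExpression I I' f x₀ x₁) y a)
        (fderiv ℝ (chartExpression I I' f x₀ x₁) y b) = chartMetric I x₀ y a b := by
  set ψ := chartExpression I I' f x₀ x₁
  have hψ : MDifferentiableAt 𝓘(ℝ, E) 𝓘(ℝ, E') ψ y :=
    (contDiffAt_chartExpression hf.contMDiff hy hfy).contMDiffAt.mdifferentiableAt (by simp)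
  have hsymm : MDifferentiableAt 𝓘(ℝ, E') I' (extChartAt I' x₁).symm (ψ y) :=
    (contMDiffAt_extChartAt_symm ((extChartAt I' x₁).map_source hfy)).mdifferentiableAt (by simp)
  have heq : (extChartAt I' x₁).symm ∘ ψ =ᶠ[𝓝 y] f ∘ (extChartAt I x₀).symm := by
    filter_upwards [eventually_mem_chartExpression_domain hf.contMDiff.continuous hy hfy]
      with z hz
    exact (extChartAt I' x₁).left_inv hz.2
  rw [← mfderiv_eq_fderiv]
  calc _ = pullbackMetric 𝓘(ℝ, E) I' ((extChartAt I' x₁).symm ∘ ψ) y a b :=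
        (RelEq.pullbackMetric_comp hsymm hψ a b).symm
    _ = pullbackMetric 𝓘(ℝ, E) I' (f ∘ (extChartAt I x₀).symm) y a b :=
        pullbackMetric_congr heq a b
    _ = chartMetric I x₀ y a b :=
        hf.pullbackMetric_comp ((contMDiffAt_extChartAt_symm hy).mdifferentiableAt (by simp)) a b

end IsRiemannianLocalIsometry

theorem contDiffAt_curve_in_chart [IsManifold I ∞ Q] {c : ℝ → Q} {s : Set ℝ} (hs : IsOpen s)
    (hc : ContMDiffOn 𝓘(ℝ, ℝ) I ∞ c s) {x₀ : Q} {t : ℝ} (ht : t ∈ s)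
    (hct : c t ∈ (extChartAt I x₀).source) :
    ContDiffAt ℝ ∞ (extChartAt I x₀ ∘ c) t := by
  rw [← contMDiffAt_iff_contDiffAt]
  rw [extChartAt_source] at hct
  exact (contMDiffAt_extChartAt' hct).comp t (hc.contMDiffAt (hs.mem_nhds ht))

section Geodesics

variable [RiemannianBundle (fun q : Q ↦ TangentSpace I q)]

theorem IsGeodesicFrom.mdifferentiableAt_zero {q : Q} {v : TangentSpace I q} {c : ℝ → Q}
    (hc : IsGeodesicFrom I q v c) : MDifferentiableAt 𝓘(ℝ, ℝ) I c 0 := by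
  obtain ⟨⟨δ, hδ, hgeo⟩, -⟩ := hc
  exact (hgeo.1.contMDiffAt (Ioo_mem_nhds (by linarith) (by linarith))).mdifferentiableAt (by simp)

variable [RiemannianBundle (fun q : Q' ↦ TangentSpace I' q)]
  [I.Boundaryless] [IsManifold I ∞ Q] [I'.Boundaryless] [IsManifold I' ∞ Q']
  [IsContMDiffRiemannianBundle I ∞ E (fun q : Q ↦ TangentSpace I q)]
  [IsContMDiffRiemannianBundle I' ∞ E' (fun q : Q' ↦ TangentSpace I' q)] {f : Q → Q'}
  {c : ℝ → Q}

theorem IsGeodesicOn.comp_localIsometry {s : Set ℝ} (hc : IsGeodesicOn I c s) (hs : IsOpen s)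
    (hf : IsRiemannianLocalIsometry I I' f) : IsGeodesicOn I' (f ∘ c) s := by
  rw [isGeodesicOn_iff_satisfiesGeodesicEquation] at hc ⊢
  obtain ⟨hsmooth, hgeo⟩ := hc
  refine ⟨hf.contMDiff.comp_contMDiffOn hsmooth, fun x₁ t ht hfct ↦ ?_⟩
  set φ := extChartAt I (c t)
  have hct : c t ∈ φ.source := mem_extChartAt_source (c t)
  have hy : (φ ∘ c) t ∈ φ.target := φ.map_source hct
  have hfy : f (φ.symm ((φ ∘ c) t)) ∈ (extChartAt I' x₁).source := by
    rwa [Function.comp_apply, φ.left_inv hct]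
  set ψ := chartExpression I I' f (c t) x₁
  have hcurve : extChartAt I' x₁ ∘ f ∘ c =ᶠ[𝓝 t] ψ ∘ φ ∘ c := by
    filter_upwards [(hsmooth.contMDiffAt (hs.mem_nhds ht)).continuousAt.eventually_mem
      ((isOpen_extChartAt_source (c t)).mem_nhds hct)] with r hr
    exact congrArg (extChartAt I' x₁ ∘ f) (φ.left_inv hr).symm
  have hpull : ∀ᶠ z in 𝓝 ((φ ∘ c) t), ∀ a b, chartForm I (c t) z a b =
      chartForm I' x₁ (ψ z) (fderiv ℝ ψ z a) (fderiv ℝ ψ z b) := by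
    filter_upwards [eventually_mem_chartExpression_domain hf.contMDiff.continuous hy hfy]
      with z hz a b
    exact (hf.chartMetric_chartExpression hz.1 hz.2 a b).symm
  refine .congr ((hgeo (c t) t ht hct).comp
    ((contDiffAt_curve_in_chart hs hsmooth ht hct).of_le ENat.LEInfty.out)
    ((contDiffAt_chartExpression hf.contMDiff hy hfy).of_le ENat.LEInfty.out)
    (surjective_fderiv_chartExpression hf.contMDiff hy hfy (hf.surjective_mfderiv _))
    ((contDiffAt_chartForm I hy).differentiableAt (by simp))
    ((contDiffAt_chartForm I' ((extChartAt I' x₁).map_source hfy)).differentiableAt (by simp))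
    (chartForm_comm I' x₁ _) hpull) hcurve.symm

theorem IsGeodesicFrom.comp_localIsometry {q : Q} {v : TangentSpace I q}
    (hc : IsGeodesicFrom I q v c) (hf : IsRiemannianLocalIsometry I I' f) :
    IsGeodesicFrom I' (f q) (mfderiv I I' f q v) (f ∘ c) := by
  have hdiff := hc.mdifferentiableAt_zero
  obtain ⟨⟨δ, hδ, hgeo⟩, hvel⟩ := hc
  refine ⟨⟨δ, hδ, hgeo.comp_localIsometry isOpen_Ioo hf⟩, ?_⟩
  exact (tangentMap_comp_at (⟨0, 1⟩ : TangentBundle 𝓘(ℝ, ℝ) ℝ)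
    (hf.contMDiff.mdifferentiableAt (by simp)) hdiff).trans
    (congrArg (tangentMap I I' f) hvel)

end Geodesics

end LocalIsometry

section Uniqueness

variable {E : Type*} [NormedAddCommGroup E] [NormedSpace ℝ E]
  {HQ : Type*} [TopologicalSpace HQ] {I : ModelWithCorners ℝ E HQ}
  {Q : Type*} [TopologicalSpace Q] [ChartedSpace HQ Q]

theorem deriv_curve_in_chart [IsManifold I ∞ Q] {c : ℝ → Q} {t : ℝ}
    (hc : MDifferentiableAt 𝓘(ℝ, ℝ) I c t) {x₀ : Q} (hct : c t ∈ (extChartAt I x₀).source) :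
    deriv (extChartAt I x₀ ∘ c) t =
      mfderiv I 𝓘(ℝ, E) (extChartAt I x₀) (c t) (mfderiv 𝓘(ℝ, ℝ) I c t (1 : ℝ)) := by
  have hchart : MDifferentiableAt I 𝓘(ℝ, E) (extChartAt I x₀) (c t) :=
    mdifferentiableAt_extChartAt (by rwa [← extChartAt_source I])
  rw [← fderiv_apply_one_eq_deriv, ← mfderiv_eq_fderiv, mfderiv_comp t hchart hc]
  rfl

variable [RiemannianBundle (fun q : Q ↦ TangentSpace I q)]

theorem IsGeodesicOn.mono {c : ℝ → Q} {s s' : Set ℝ} (hc : IsGeodesicOn I c s) (h : s' ⊆ s) :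
    IsGeodesicOn I c s' :=
  ⟨hc.1.mono h, fun x₀ t ht ↦ hc.2 x₀ t (h ht)⟩

variable [CompleteSpace E] [I.Boundaryless] [IsManifold I ∞ Q]
  [IsContMDiffRiemannianBundle I ∞ E (fun q : Q ↦ TangentSpace I q)]

theorem IsGeodesicOn.eventuallyEq {c₁ c₂ : ℝ → Q} {s : Set ℝ} (h₁ : IsGeodesicOn I c₁ s)
    (h₂ : IsGeodesicOn I c₂ s) (hs : IsOpen s) {t : ℝ} (ht : t ∈ s) {x₀ : Q}
    (hct : c₁ t ∈ (extChartAt I x₀).source) (heq : c₁ t = c₂ t)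
    (hderiv : deriv (extChartAt I x₀ ∘ c₁) t = deriv (extChartAt I x₀ ∘ c₂) t) :
    c₁ =ᶠ[𝓝 t] c₂ := by
  have hct₂ : c₂ t ∈ (extChartAt I x₀).source := heq ▸ hct
  have hy : extChartAt I x₀ (c₁ t) ∈ (extChartAt I x₀).target := (extChartAt I x₀).map_source hct
  have hmem {c : ℝ → Q} (hc : IsGeodesicOn I c s) (hct : c t ∈ (extChartAt I x₀).source) :
      ∀ᶠ r in 𝓝 t, c r ∈ (extChartAt I x₀).source :=
    (hc.1.contMDiffAt (hs.mem_nhds ht)).continuousAt.eventually_mem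
      ((isOpen_extChartAt_source x₀).mem_nhds hct)
  have hgeo {c : ℝ → Q} (hc : IsGeodesicOn I c s) (hct : c t ∈ (extChartAt I x₀).source) :
      ∀ᶠ r in 𝓝 t, SatisfiesGeodesicEquation (chartForm I x₀) (extChartAt I x₀ ∘ c) r := by
    filter_upwards [hs.eventually_mem ht, hmem hc hct] with r hr hcr
    exact ((isGeodesicOn_iff_satisfiesGeodesicEquation I).1 hc).2 x₀ r hr hcr
  have hcoord : extChartAt I x₀ ∘ c₁ =ᶠ[𝓝 t] extChartAt I x₀ ∘ c₂ :=
    eventuallyEq_of_satisfiesGeodesicEquation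
      ((contDiffAt_chartForm I hy).of_le ENat.LEInfty.out)
      (((isOpen_extChartAt_target x₀).eventually_mem hy).mono fun _ ↦ isInvertible_chartForm I)
      ((contDiffAt_curve_in_chart hs h₁.1 ht hct).of_le ENat.LEInfty.out)
      ((contDiffAt_curve_in_chart hs h₂.1 ht hct₂).of_le ENat.LEInfty.out)
      (hgeo h₁ hct) (hgeo h₂ hct₂) (congrArg (extChartAt I x₀) heq) hderiv
  filter_upwards [hcoord, hmem h₁ hct, hmem h₂ hct₂] with r hr hr₁ hr₂
  exact (extChartAt I x₀).injOn hr₁ hr₂ hr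

variable [T2Space Q]

theorem IsGeodesicOn.eqOn {c₁ c₂ : ℝ → Q} {s : Set ℝ} (h₁ : IsGeodesicOn I c₁ s)
    (h₂ : IsGeodesicOn I c₂ s) (hs : IsOpen s) (hconn : IsPreconnected s) {t₀ : ℝ} (ht₀ : t₀ ∈ s)
    (h₀ : c₁ =ᶠ[𝓝 t₀] c₂) : EqOn c₁ c₂ s := by
  suffices hsub : s ⊆ {t | c₁ =ᶠ[𝓝 t] c₂} from fun t ht ↦ (hsub ht).self_of_nhds
  refine hconn.subset_of_closure_inter_subset isOpen_setOfPred_eventually_nhds ⟨t₀, ht₀, h₀⟩ ?_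
  rintro t ⟨hcl, ht⟩
  rw [mem_closure_iff_frequently] at hcl
  have hcont {c : ℝ → Q} (hc : IsGeodesicOn I c s) : ContinuousAt c t :=
    (hc.1.contMDiffAt (hs.mem_nhds ht)).continuousAt
  have heq : c₁ t = c₂ t := tendsto_nhds_unique_of_frequently_eq (hcont h₁) (hcont h₂)
    (hcl.mono fun r hr ↦ hr.self_of_nhds)
  have hct : c₁ t ∈ (extChartAt I (c₁ t)).source := mem_extChartAt_source (c₁ t)
  have hderiv_cont {c : ℝ → Q} (hc : IsGeodesicOn I c s)
      (hct : c t ∈ (extChartAt I (c₁ t)).source) :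
      ContinuousAt (deriv (extChartAt I (c₁ t) ∘ c)) t :=
    (contDiffAt_deriv
      ((contDiffAt_curve_in_chart hs hc.1 ht hct).of_le ENat.LEInfty.out)).continuousAt
  exact h₁.eventuallyEq h₂ hs ht hct heq <|
    tendsto_nhds_unique_of_frequently_eq (hderiv_cont h₁ hct) (hderiv_cont h₂ (heq ▸ hct))
      (hcl.mono fun r hr ↦ (hr.fun_comp (extChartAt I (c₁ t))).deriv_eq)

theorem IsGeodesicFrom.eq_at_one {q : Q} {v : TangentSpace I q} {c₁ c₂ : ℝ → Q}
    (h₁ : IsGeodesicFrom I q v c₁) (h₂ : IsGeodesicFrom I q v c₂) : c₁ 1 = c₂ 1 := by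
  have hvel := h₁.2.trans h₂.2.symm
  have hsource : c₁ 0 ∈ (extChartAt I (c₁ 0)).source := mem_extChartAt_source (c₁ 0)
  have heq : c₁ 0 = c₂ 0 := congrArg TotalSpace.proj hvel
  have hderiv : deriv (extChartAt I (c₁ 0) ∘ c₁) 0 = deriv (extChartAt I (c₁ 0) ∘ c₂) 0 := by
    rw [deriv_curve_in_chart h₁.mdifferentiableAt_zero hsource,
      deriv_curve_in_chart h₂.mdifferentiableAt_zero (heq ▸ hsource)]
    exact congrArg (fun p : TangentBundle I Q ↦
      mfderiv I 𝓘(ℝ, E) (extChartAt I (c₁ 0)) p.1 p.2) hvel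
  obtain ⟨⟨δ₁, hδ₁, hgeo₁⟩, -⟩ := h₁
  obtain ⟨⟨δ₂, hδ₂, hgeo₂⟩, -⟩ := h₂
  have hδ : 0 < min δ₁ δ₂ := lt_min hδ₁ hδ₂
  have h0 : (0 : ℝ) ∈ Ioo (-(min δ₁ δ₂)) (1 + min δ₁ δ₂) := ⟨by linarith, by linarith⟩
  have h1 : (1 : ℝ) ∈ Ioo (-(min δ₁ δ₂)) (1 + min δ₁ δ₂) := ⟨by linarith, by linarith⟩
  replace hgeo₁ : IsGeodesicOn I c₁ (Ioo (-(min δ₁ δ₂)) (1 + min δ₁ δ₂)) :=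
    hgeo₁.mono (Ioo_subset_Ioo (by gcongr; exact min_le_left ..) (by gcongr; exact min_le_left ..))
  replace hgeo₂ : IsGeodesicOn I c₂ (Ioo (-(min δ₁ δ₂)) (1 + min δ₁ δ₂)) :=
    hgeo₂.mono
      (Ioo_subset_Ioo (by gcongr; exact min_le_right ..) (by gcongr; exact min_le_right ..))
  exact hgeo₁.eqOn hgeo₂ isOpen_Ioo isPreconnected_Ioo h0
    (hgeo₁.eventuallyEq hgeo₂ isOpen_Ioo h0 hsource heq hderiv) h1

end Uniqueness

section Exponential

variable {E : Type*} [NormedAddCommGroup E] [NormedSpace ℝ E]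
  {HQ : Type*} [TopologicalSpace HQ] {I : ModelWithCorners ℝ E HQ}
  {Q : Type*} [TopologicalSpace Q] [ChartedSpace HQ Q]
  [RiemannianBundle (fun q : Q ↦ TangentSpace I q)]

theorem exists_isGeodesicFrom_eq_Exp {q : Q} {v : TangentSpace I q} (hv : v ∈ expDomain I q) :
    ∃ c : ℝ → Q, IsGeodesicFrom I q v c ∧ c 1 = Exp I q v :=
  ⟨_, hv.choose_spec, by rw [Exp, dif_pos hv.out]⟩

variable [I.Boundaryless] [IsManifold I ∞ Q]
  [IsContMDiffRiemannianBundle I ∞ E (fun q : Q ↦ TangentSpace I q)]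

theorem isGeodesicFrom_const (q : Q) : IsGeodesicFrom I q 0 (fun _ ↦ q) := by
  refine ⟨⟨1, one_pos, (isGeodesicOn_iff_satisfiesGeodesicEquation I).2
    ⟨contMDiffOn_const, fun x₀ t _ _ ↦ satisfiesGeodesicEquation_iff.2 fun w ↦ ?_⟩⟩, ?_⟩
  · simp [Function.comp_def, christoffelCovector_apply]
  · rw [mfderiv_const]
    rfl

variable [CompleteSpace E] [T2Space Q]

theorem Exp_eq {q : Q} {v : TangentSpace I q} {c : ℝ → Q} (hc : IsGeodesicFrom I q v c) :
    Exp I q v = c 1 := by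
  obtain ⟨c', hc', h⟩ := exists_isGeodesicFrom_eq_Exp ⟨c, hc⟩
  rw [← h, hc'.eq_at_one hc]

variable (I) in
theorem Exp_zero (q : Q) : Exp I q 0 = q :=
  Exp_eq (isGeodesicFrom_const q)

end Exponential

section Naturality

variable {E : Type*} [NormedAddCommGroup E] [NormedSpace ℝ E]
  {HQ : Type*} [TopologicalSpace HQ] {I : ModelWithCorners ℝ E HQ} [I.Boundaryless]
  {Q : Type*} [TopologicalSpace Q] [ChartedSpace HQ Q] [IsManifold I ∞ Q]
  [RiemannianBundle (fun q : Q ↦ TangentSpace I q)]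
  [IsContMDiffRiemannianBundle I ∞ E (fun q : Q ↦ TangentSpace I q)]
  {E' : Type*} [NormedAddCommGroup E'] [NormedSpace ℝ E'] [CompleteSpace E']
  {HQ' : Type*} [TopologicalSpace HQ'] {I' : ModelWithCorners ℝ E' HQ'} [I'.Boundaryless]
  {Q' : Type*} [TopologicalSpace Q'] [T2Space Q'] [ChartedSpace HQ' Q'] [IsManifold I' ∞ Q']
  [RiemannianBundle (fun q : Q' ↦ TangentSpace I' q)]
  [IsContMDiffRiemannianBundle I' ∞ E' (fun q : Q' ↦ TangentSpace I' q)]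

theorem IsRiemannianLocalIsometry.Exp_mfderiv
    {f : Q → Q'} (hf : IsRiemannianLocalIsometry I I' f) {q : Q} {v : TangentSpace I q}
    (hv : v ∈ expDomain I q) : Exp I' (f q) (mfderiv I I' f q v) = f (Exp I q v) := by
  obtain ⟨c, hc, hc1⟩ := exists_isGeodesicFrom_eq_Exp hv
  rw [Exp_eq (hc.comp_localIsometry hf), Function.comp_apply, hc1]

end Naturality

section IsometricActions

variable {E : Type*} [NormedAddCommGroup E] [NormedSpace ℝ E]
  {HQ : Type*} [TopologicalSpace HQ] {I : ModelWithCorners ℝ E HQ}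
  {Q : Type*} [TopologicalSpace Q] [ChartedSpace HQ Q]
  {G : Type*} [Group G] [MulAction G Q]

theorem tangentAction_one {q : Q} (v : TangentSpace I q) :
    tangentAction I (1 : stabilizer G q) v = v := by
  have hone : (fun x : Q ↦ ((1 : stabilizer G q) : G) • x) = id := funext (one_smul G)
  rw [tangentAction, hone, mfderiv_id]
  rfl

variable [RiemannianBundle (fun q : Q ↦ TangentSpace I q)]

theorem ActsByIsometries.isRiemannianLocalIsometry (hisom : ActsByIsometries I Q G)
    (hact : ∀ g : G, ContMDiff I I ∞ (fun x : Q ↦ g • x)) (g : G) :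
    IsRiemannianLocalIsometry I I (fun x : Q ↦ g • x) where
  contMDiff := hact g
  inner_mfderiv := hisom g
  surjective_mfderiv x := by
    let Φ : Diffeomorph I I Q Q ∞ := ⟨MulAction.toPerm g, hact g, hact g⁻¹⟩
    exact (Φ.mfderivToContinuousLinearEquiv (by simp) x).surjective

variable [CompleteSpace E] [I.Boundaryless] [T2Space Q] [IsManifold I ∞ Q]
  [IsContMDiffRiemannianBundle I ∞ E (fun q : Q ↦ TangentSpace I q)]

theorem Exp_tangentAction (hisom : ActsByIsometries I Q G)
    (hact : ∀ g : G, ContMDiff I I ∞ (fun x : Q ↦ g • x)) {q : Q} (h : stabilizer G q)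
    {v : TangentSpace I q} (hv : v ∈ expDomain I q) :
    Exp I q (tangentAction I h v) = h • Exp I q v := by
  have Exp_congr {x y : Q} (hxy : x = y) (w : E) : Exp I x w = Exp I y w := by
    subst hxy; rfl
  calc Exp I q (tangentAction I h v)
    _ = Exp I ((h : G) • q) (mfderiv I I (fun x : Q ↦ (h : G) • x) q v) :=
        Exp_congr (mem_stabilizer_iff.1 h.2).symm _
    _ = h • Exp I q v := (hisom.isRiemannianLocalIsometry hact (h : G)).Exp_mfderiv hv

end IsometricActions

section ExpNeighborhood

variable {E : Type*} [NormedAddCommGroup E] [NormedSpace ℝ E]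
  {HQ : Type*} [TopologicalSpace HQ] {I : ModelWithCorners ℝ E HQ}
  {Q : Type*} [TopologicalSpace Q] [ChartedSpace HQ Q]
  [RiemannianBundle (fun q : Q ↦ TangentSpace I q)]
  {G : Type*} [Group G] [MulAction G Q] {q : Q} {V : Set (TangentSpace I q)} {v : TangentSpace I q}

namespace IsExpNeighborhood

theorem hasMFDerivAt_Exp (hV : IsExpNeighborhood I G q V) (hv : v ∈ V) :
    HasMFDerivAt 𝓘(ℝ, TangentSpace I q) I (Exp I q) v
      (mfderiv 𝓘(ℝ, TangentSpace I q) I (Exp I q) v) :=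
  ((hV.smooth.contMDiffAt (hV.isOpen.mem_nhds hv)).mdifferentiableAt (by simp)).hasMFDerivAt

theorem isInvertible_mfderiv_Exp (hV : IsExpNeighborhood I G q V) (hv : v ∈ V) :
    (mfderiv 𝓘(ℝ, TangentSpace I q) I (Exp I q) v).IsInvertible := by
  obtain ⟨Log, hLog, hsmooth⟩ := hV.smooth_inverse
  have himage : Exp I q '' V ∈ 𝓝 (Exp I q v) := hV.isOpen_image.mem_nhds (mem_image_of_mem _ hv)
  have hExp := hV.hasMFDerivAt_Exp hv
  have hLog' := ((hsmooth.contMDiffAt himage).mdifferentiableAt (by simp)).hasMFDerivAt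
  have hLog_Exp : HasMFDerivAt 𝓘(ℝ, TangentSpace I q) 𝓘(ℝ, TangentSpace I q)
      (Log ∘ Exp I q) v (.id ℝ _) :=
    (hasMFDerivAt_id v).congr_of_eventuallyEq
      (Filter.eventuallyEq_of_mem (hV.isOpen.mem_nhds hv) hLog)
  have hExp_Log : HasMFDerivAt I I (Exp I q ∘ Log) (Exp I q v) (.id ℝ _) := by
    refine (hasMFDerivAt_id _).congr_of_eventuallyEq (Filter.eventuallyEq_of_mem himage ?_)
    rintro _ ⟨w, hw, rfl⟩
    exact congrArg (Exp I q) (hLog hw)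
  refine .of_inverse (hasMFDerivAt_unique (HasMFDerivAt.comp _ ?_ hLog') hExp_Log)
    (hasMFDerivAt_unique (hLog'.comp v hExp) hLog_Exp)
  rwa [hLog hv]

theorem mfderiv_Exp_expPullback (hV : IsExpNeighborhood I G q V) (hv : v ∈ V)
    (X : Π q : Q, TangentSpace I q) :
    mfderiv 𝓘(ℝ, TangentSpace I q) I (Exp I q) v (expPullback I q X v) = X (Exp I q v) :=
  (hV.isInvertible_mfderiv_Exp hv).self_apply_inverse _

end IsExpNeighborhood

variable [CompleteSpace E] [I.Boundaryless] [T2Space Q] [IsManifold I ∞ Q]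
  [IsContMDiffRiemannianBundle I ∞ E (fun q : Q ↦ TangentSpace I q)]

theorem stabilizer_Exp_eq_tangentIsotropy (hisom : ActsByIsometries I Q G)
    (hact : ∀ g : G, ContMDiff I I ∞ (fun x : Q ↦ g • x)) (hV : IsExpNeighborhood I G q V)
    (hv : v ∈ V) :
    (stabilizer (stabilizer G q) (Exp I q v) : Set (stabilizer G q)) = tangentIsotropy I G v := by
  ext h
  rw [SetLike.mem_coe, mem_stabilizer_iff, ← Exp_tangentAction hisom hact h (hV.subset_domain hv)]
  exact hV.injOn.eq_iff (hV.invariant h v hv) hv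

theorem IsTangentRelativeEquilibrium.isRelativeEquilibrium_Exp
    {F : Type*} [NormedAddCommGroup F] [NormedSpace ℝ F]
    {HG : Type*} [TopologicalSpace HG] {J : ModelWithCorners ℝ F HG}
    [TopologicalSpace G] [ChartedSpace HG G] {X : Π q : Q, TangentSpace I q}
    (h : IsTangentRelativeEquilibrium I J G q (expPullback I q X) v)
    (hisom : ActsByIsometries I Q G) (hact : ∀ g : G, ContMDiff I I ∞ (fun x : Q ↦ g • x))
    (hV : IsExpNeighborhood I G q V) (hv : v ∈ V) :
    IsRelativeEquilibrium I J G X (Exp I q v) := by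
  obtain ⟨ξ, c, hc, hderiv⟩ := h
  refine ⟨ξ, fun t ↦ (c t : G), hc, ?_⟩
  have hcurve : (fun t ↦ (c t : G) • Exp I q v) = Exp I q ∘ fun t ↦ tangentAction I (c t) v :=
    funext fun t ↦ (Exp_tangentAction hisom hact (c t) (hV.subset_domain hv)).symm
  have hc0 : c 0 = 1 := Subtype.ext (congrArg TotalSpace.proj hc.2.2)
  have hExp : HasMFDerivAt 𝓘(ℝ, TangentSpace I q) I (Exp I q) (tangentAction I (c 0) v)
      (mfderiv 𝓘(ℝ, TangentSpace I q) I (Exp I q) v) := by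
    rw [hc0, tangentAction_one]
    exact hV.hasMFDerivAt_Exp hv
  have hX : (X ((c 0 : G) • Exp I q v) : E) = X (Exp I q v) :=
    congrArg (fun x ↦ (X x : E)) (by rw [hc0, OneMemClass.coe_one, one_smul])
  have hderiv' : HasMFDerivAt 𝓘(ℝ, ℝ) 𝓘(ℝ, TangentSpace I q) (fun t ↦ tangentAction I (c t) v) 0
      ((1 : ℝ →L[ℝ] ℝ).smulRight (expPullback I q X v)) :=
    hasMFDerivAt_iff_hasFDerivAt.2 hderiv.hasFDerivAt
  have hpush : mfderiv 𝓘(ℝ, TangentSpace I q) I (Exp I q) v ((1 : ℝ) • expPullback I q X v) =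
      X (Exp I q v) := by rw [one_smul, hV.mfderiv_Exp_expPullback hv]
  rw [hcurve]
  exact (hExp.comp 0 hderiv').congr_mfderiv <| ContinuousLinearMap.ext_ring (R₁ := ℝ) (M₁ := E) <|
    hpush.trans (hX.symm.trans (one_smul ℝ _).symm)

end ExpNeighborhood

theorem IsConjugateTo.refl {Γ : Type*} [Group Γ] (H : Subgroup Γ) :
    IsConjugateTo (H : Set Γ) H :=
  ⟨1, by simp⟩

end RelEq

end

theorem mainTheorem6_general
    {E : Type*} [NormedAddCommGroup E] [NormedSpace ℝ E] [CompleteSpace E]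
    {HQ : Type*} [TopologicalSpace HQ] (I : ModelWithCorners ℝ E HQ) [I.Boundaryless]
    {Q : Type*} [TopologicalSpace Q] [T2Space Q] [ChartedSpace HQ Q] [IsManifold I ∞ Q]
    [RiemannianBundle (fun q : Q ↦ TangentSpace I q)]
    [IsContMDiffRiemannianBundle I ∞ E (fun q : Q ↦ TangentSpace I q)]
    {F : Type*} [NormedAddCommGroup F] [NormedSpace ℝ F]
    {HG : Type*} [TopologicalSpace HG] (J : ModelWithCorners ℝ F HG)
    {G : Type*} [TopologicalSpace G] [ChartedSpace HG G] [Group G] [MulAction G Q]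
    (hact : ∀ g : G, ContMDiff I I ∞ (fun x : Q ↦ g • x))
    (hisom : RelEq.ActsByIsometries I Q G)
    {Λ : Type*} [TopologicalSpace Λ] (X : Λ → Π q : Q, TangentSpace I q) (S : Set Λ)
    (l₀ : Λ) (qe : Q) (hqe : RelEq.IsRelativeEquilibrium I J G (X l₀) qe)
    (V : Set (TangentSpace I qe)) (hV : RelEq.IsExpNeighborhood I G qe V)
    (H : Subgroup (stabilizer G qe))
    (γ : Λ → TangentSpace I qe) (hγ : ContinuousOn γ S) (hγV : MapsTo γ S V) (hγ₀ : γ l₀ = 0)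
    (hγeq : ∀ l ∈ S \ {l₀},
      RelEq.IsTangentRelativeEquilibrium I J G qe (RelEq.expPullback I qe (X l)) (γ l))
    (hγiso : ∀ l ∈ S \ {l₀}, RelEq.IsConjugateTo (RelEq.tangentIsotropy I G (γ l)) H) :
    ContinuousOn (fun l ↦ RelEq.Exp I qe (γ l)) S ∧
    MapsTo (fun l ↦ RelEq.Exp I qe (γ l)) S (RelEq.Exp I qe '' V) ∧
    (∀ l ∈ S, RelEq.IsRelativeEquilibrium I J G (X l) (RelEq.Exp I qe (γ l))) ∧
    (∀ l ∈ S \ {l₀},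
      RelEq.IsConjugateTo
        (stabilizer (stabilizer G qe) (RelEq.Exp I qe (γ l)) : Set (stabilizer G qe)) H) ∧
    RelEq.IsConjugateTo
      (stabilizer (stabilizer G qe) (RelEq.Exp I qe (γ l₀)) : Set (stabilizer G qe)) ⊤ ∧
    RelEq.IsConjugateTo (stabilizer G (RelEq.Exp I qe (γ l₀)) : Set G) (stabilizer G qe) := by
  have hExp₀ : RelEq.Exp I qe (γ l₀) = qe := by rw [hγ₀, RelEq.Exp_zero]
  refine ⟨hV.smooth.continuousOn.comp hγ hγV, fun l hl ↦ mem_image_of_mem _ (hγV hl),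
    fun l hl ↦ ?_, fun l hl ↦ ?_, ?_, ?_⟩
  · rcases eq_or_ne l l₀ with rfl | hne
    · rwa [hExp₀]
    · exact (hγeq l ⟨hl, hne⟩).isRelativeEquilibrium_Exp hisom hact hV (hγV hl)
  · rw [RelEq.stabilizer_Exp_eq_tangentIsotropy hisom hact hV (hγV hl.1)]
    exact hγiso l hl
  · have htop : stabilizer (stabilizer G qe) qe = ⊤ := eq_top_iff.2 fun h _ ↦ h.2
    rw [hExp₀, htop]
    exact RelEq.IsConjugateTo.refl ⊤
  · rw [hExp₀]
    exact RelEq.IsConjugateTo.refl (stabilizer G qe)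

theorem mainTheorem6
    {E : Type*} [NormedAddCommGroup E] [NormedSpace ℝ E] [FiniteDimensional ℝ E]
    {HQ : Type*} [TopologicalSpace HQ] (I : ModelWithCorners ℝ E HQ) [I.Boundaryless]
    {Q : Type*} [TopologicalSpace Q] [T2Space Q] [ChartedSpace HQ Q] [IsManifold I ∞ Q]
    [RiemannianBundle (fun q : Q ↦ TangentSpace I q)]
    [IsContMDiffRiemannianBundle I ∞ E (fun q : Q ↦ TangentSpace I q)]
    {F : Type*} [NormedAddCommGroup F] [NormedSpace ℝ F] [FiniteDimensional ℝ F]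
    {HG : Type*} [TopologicalSpace HG] (J : ModelWithCorners ℝ F HG) [J.Boundaryless]
    {G : Type*} [TopologicalSpace G] [T2Space G] [ChartedSpace HG G] [Group G] [LieGroup J ∞ G]
    [MulAction G Q] [ContMDiffSMul J I ∞ G Q] [ProperSMul G Q]
    (hisom : RelEq.ActsByIsometries I Q G)
    (X : ℝ → Π q : Q, TangentSpace I q)
    (hsmooth : ∀ l, RelEq.IsSmoothVectorField I (X l))
    (hequiv : ∀ l, RelEq.IsEquivariant I G (X l))
    (l₀ : ℝ) (qe : Q) (hqe : RelEq.IsRelativeEquilibrium I J G (X l₀) qe)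
    (V : Set (TangentSpace I qe)) (hV : RelEq.IsExpNeighborhood I G qe V)
    (H : Subgroup (stabilizer G qe))
    (ε : ℝ) (hε : 0 < ε)
    (γ : ℝ → TangentSpace I qe) (hγ : ContinuousOn γ (Icc l₀ (l₀ + ε)))
    (hγV : MapsTo γ (Icc l₀ (l₀ + ε)) V) (hγ₀ : γ l₀ = 0)
    (hγeq : ∀ l ∈ Ioc l₀ (l₀ + ε),
      RelEq.IsTangentRelativeEquilibrium I J G qe (RelEq.expPullback I qe (X l)) (γ l))
    (hγiso : ∀ l ∈ Ioc l₀ (l₀ + ε),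
      RelEq.IsConjugateTo (RelEq.tangentIsotropy I G (γ l)) H) :
    ContinuousOn (fun l ↦ RelEq.Exp I qe (γ l)) (Icc l₀ (l₀ + ε)) ∧
    MapsTo (fun l ↦ RelEq.Exp I qe (γ l)) (Icc l₀ (l₀ + ε)) (RelEq.Exp I qe '' V) ∧
    (∀ l ∈ Icc l₀ (l₀ + ε),
      RelEq.IsRelativeEquilibrium I J G (X l) (RelEq.Exp I qe (γ l))) ∧
    (∀ l ∈ Ioc l₀ (l₀ + ε),
      RelEq.IsConjugateTo
        (stabilizer (stabilizer G qe) (RelEq.Exp I qe (γ l)) : Set (stabilizer G qe)) H) ∧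
    RelEq.IsConjugateTo
      (stabilizer (stabilizer G qe) (RelEq.Exp I qe (γ l₀)) : Set (stabilizer G qe)) ⊤ ∧
    RelEq.IsConjugateTo (stabilizer G (RelEq.Exp I qe (γ l₀)) : Set G) (stabilizer G qe) := by
  have : CompleteSpace E := FiniteDimensional.complete ℝ E
  simp only [← Icc_sdiff_left] at hγeq hγiso ⊢
  exact mainTheorem6_general I J (ContMDiffSMul.contMDiff_const_smul (I := J)) hisom X _ l₀ qe hqe
    V hV H γ hγ hγV hγ₀ hγeq hγiso
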